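/- A signature $(\mathbb L,\mathbb U)$ consists of a collection $\mathbb L$ of predicate and function symbols of various arities and a nonempty collection $\mathbb U$ of nonempty subsets of $\mathbb N$. Formulas over it are built from atomic formulas $\tau=\sigma$ and $P\tau_1\dots\tau_n$ (with $\tau,\sigma,\tau_i$ terms over variables $v_0,v_1,\dots$) by $\neg$, $\wedge$, $\exists x$, and a binary connective $\succeq_X$ for every $X\in\mathbb U$. A utility model is a tuple $M=\langle D,W,t,u,s\rangle$ where $D$ (domain) and $W$ (worlds) are nonempty sets, $t$ gives for each world $w$ an interpretation over $D$ of all symbols of $\mathbb L$, $u_X:W\to\mathbb R$ for each $X\in\mathbb U$, and $s$ assigns to each world $w$ and each nonempty $A\subseteq W$ a world $s(w,A)\in A$. A preorder model $\langle D,W,t,\unrhd,s\rangle$ is the same except that $u$ is replaced by a map assigning to each $X\in\mathbb U$ a total preorder $\unrhd_X$ (a reflexive, transitive, connected relation) on $W$. Given a model $M$ and an assignment $d$ of elements of $D$ to the variables, each formula $\varphi$ expresses a set of worlds $\varphi[M,d]\subseteq W$. An atomic formula expresses the set of worlds $w$ at which it holds under $d$ and $t(w,\cdot)$; $\neg$ and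 $\wedge$ are interpreted as complement in $W$ and intersection; $w\in(\exists x\,\psi)[M,d]$ iff $w\in\psi[M,d']$ for some $d'$ differing from $d$ at most at $x$. Finally, $(\theta\succeq_X\psi)[M,d]$ is empty if $\theta[M,d]$ or $\psi[M,d]$ is empty, and otherwise it is the set of $w\in W$ such that $u_X(s(w,\theta[M,d]))\ge u_X(s(w,\psi[M,d]))$ if $M$ is a utility model, respectively $s(w,\theta[M,d])\unrhd_X s(w,\psi[M,d])$ if $M$ is a preorder model. A formula $\varphi$ is valid in a class of models if $\bigcap_d\varphi[M,d]=W$ for every model $M$ in the class. Proposition. For every signature, a formula is valid in the class of utility models if and only if it is valid in the class of preorder models. -/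

import Mathlib

universe u₁ u₂ v w

namespace PrefLogic

/-- A signature: predicate and function symbols of various arities, together with a
nonempty collection of nonempty sets of natural numbers. -/
structure Signature where
  symbols : FirstOrder.Language.{u₁, u₂}
  indices : Set (Set ℕ)
  indices_nonempty : indices.Nonempty
  nonempty_of_mem : ∀ X ∈ indices, X.Nonempty

/-- Formulas over a signature. The individual variables are indexed by `ℕ`. -/
inductive Formula (S : Signature.{u₁, u₂}) : Type (max u₁ u₂)
  /-- The atomic formula `τ = σ`. -/
  | eq (τ σ : S.symbols.Term ℕ) : Formula S
  /-- The atomic formula `P τ₁ … τₙ`. -/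
  | rel {n : ℕ} (P : S.symbols.Relations n) (τ : Fin n → S.symbols.Term ℕ) : Formula S
  | neg (θ : Formula S) : Formula S
  | and (θ ψ : Formula S) : Formula S
  /-- The existential formula `∃ vₓ ψ`. -/
  | ex (x : ℕ) (ψ : Formula S) : Formula S
  /-- The preference formula `θ ≽_X ψ`. -/
  | pref (X : S.indices) (θ ψ : Formula S) : Formula S

/-- The part common to utility models and preorder models: a nonempty domain `D`, a nonempty
set of worlds `W`, for every world an interpretation `t w` of the symbols over `D`, and a
selection function `s` choosing, from the vantage point of any world, a member of any
nonempty set of worlds. -/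
structure Base (S : Signature.{u₁, u₂}) where
  D : Type v
  W : Type w
  [nonempty_D : Nonempty D]
  [nonempty_W : Nonempty W]
  t : W → S.symbols.Structure D
  s : W → {A : Set W // A.Nonempty} → W
  s_mem : ∀ (a : W) (A : {A : Set W // A.Nonempty}), s a A ∈ A.1

/-- The proposition (set of worlds) expressed by a formula under an assignment `d`, where
`R X a b` says that the world `a` is at least as good as the world `b` according to `X`.
At a world, the terms are evaluated through the interpretation of the function symbols at
that world. A preference formula expresses the empty proposition if one of its two
constituents does. -/
def Base.meaning {S : Signature.{u₁, u₂}} (B : Base.{u₁, u₂, v, w} S)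
    (R : S.indices → B.W → B.W → Prop) : Formula S → (ℕ → B.D) → Set B.W
  | .eq τ σ, d => {a | letI := B.t a; τ.realize d = σ.realize d}
  | .rel P τ, d =>
      {a | letI := B.t a; FirstOrder.Language.Structure.RelMap P (fun i => (τ i).realize d)}
  | .neg θ, d => (B.meaning R θ d)ᶜ
  | .and θ ψ, d => B.meaning R θ d ∩ B.meaning R ψ d
  | .ex x ψ, d => {a | ∃ e : B.D, a ∈ B.meaning R ψ (Function.update d x e)}
  | .pref X θ ψ, d =>
      {a | ∃ (hθ : (B.meaning R θ d).Nonempty) (hψ : (B.meaning R ψ d).Nonempty),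
        R X (B.s a ⟨B.meaning R θ d, hθ⟩) (B.s a ⟨B.meaning R ψ d, hψ⟩)}

/-- A utility model: worlds carry a real utility for each index set `X`. -/
structure UtilityModel (S : Signature.{u₁, u₂}) extends Base.{u₁, u₂, v, w} S where
  u : S.indices → W → ℝ

/-- A preorder model: worlds carry a total preorder for each index set `X`. -/
structure PreorderModel (S : Signature.{u₁, u₂}) extends Base.{u₁, u₂, v, w} S where
  ge : S.indices → W → W → Prop
  ge_refl : ∀ X a, ge X a a
  ge_trans : ∀ X a b c, ge X a b → ge X b c → ge X a c
  ge_total : ∀ X a b, ge X a b ∨ ge X b a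

/-- The proposition expressed by a formula in a utility model under an assignment. -/
def UtilityModel.meaning {S : Signature.{u₁, u₂}} (M : UtilityModel.{u₁, u₂, v, w} S)
    (φ : Formula S) (d : ℕ → M.D) : Set M.W :=
  M.toBase.meaning (fun X a b => M.u X a ≥ M.u X b) φ d

/-- The proposition expressed by a formula in a preorder model under an assignment. -/
def PreorderModel.meaning {S : Signature.{u₁, u₂}} (M : PreorderModel.{u₁, u₂, v, w} S)
    (φ : Formula S) (d : ℕ → M.D) : Set M.W :=
  M.toBase.meaning M.ge φ d

/-- Validity in the class of utility models: the intersection, over all assignments, of the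
propositions expressed by the formula consists of all worlds, in every utility model. -/
def ValidInUtilityModels {S : Signature.{u₁, u₂}} (φ : Formula S) : Prop :=
  ∀ M : UtilityModel.{u₁, u₂, v, w} S, (⋂ d : ℕ → M.D, M.meaning φ d) = Set.univ

/-- Validity in the class of preorder models. -/
def ValidInPreorderModels {S : Signature.{u₁, u₂}} (φ : Formula S) : Prop :=
  ∀ M : PreorderModel.{u₁, u₂, v, w} S, (⋂ d : ℕ → M.D, M.meaning φ d) = Set.univ

end PrefLogic

/-!
Every utility model is a preorder model, ordered by comparing utilities, so validity in preorder
models implies validity in utility models. The converse is not immediate, because an uncountable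
total preorder need not be representable by a real function; it follows from a
Löwenheim–Skolem argument. Suppose `φ` fails in a preorder model, at a world `a₀` and an
assignment `d₀`. Only countably many propositions matter: those expressed by subformulas of `φ`
under assignments that differ from `d₀` finitely often, with new values in a countable set.
`exists_countable_isHull` provides countable sets `E` of individuals and `V` of worlds that are
closed under the function symbols of `φ`, existential witnesses and selection from these
propositions, and such that distinct propositions have distinct traces on `V`. The last condition
is what makes the selection function of the restricted model well defined: the selection from a
trace has to be the selection from the original proposition. By `IsHull.meaning_restrict` the
restricted model agrees with the original one about subformulas of `φ`, so `φ` fails there too;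
and on the countable set `V` each total preorder is represented by a utility function
(`exists_utility`), because every countable linear order embeds in `ℝ`.
-/

namespace PrefLogic

/-! ### Countable closures and utility representations -/

/-- Closure under an operation that assigns countable sets to finite sets preserves
countability. -/
theorem exists_countable_closed {Z : Type*} {A : Set Z} (hA : A.Countable)
    (Φ : Finset Z → Set Z) (hΦ : ∀ s, (Φ s).Countable) :
    ∃ C : Set Z, A ⊆ C ∧ C.Countable ∧ ∀ s : Finset Z, (s : Set Z) ⊆ C → Φ s ⊆ C := by
  let step : Set Z → Set Z := fun C => C ∪ ⋃ s ∈ {s : Finset Z | (s : Set Z) ⊆ C}, Φ s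
  let C : ℕ → Set Z := fun n => step^[n] A
  have hC : ∀ n, C (n + 1) = step (C n) := fun n => Function.iterate_succ_apply' step n A
  have hmono : Monotone C := monotone_nat_of_le_succ fun n => by
    rw [hC]; exact Set.subset_union_left
  have hcount : ∀ n, (C n).Countable := by
    intro n
    induction n with
    | zero => exact hA
    | succ n ih =>
      rw [hC]
      refine ih.union (Set.Countable.biUnion ?_ fun s _ => hΦ s)
      have := Set.Countable.preimage_of_injOn (Set.countable_ofPred_finite_subset ih)
        (f := fun s : Finset Z => (s : Set Z)) Finset.coe_injective.injOn
      exact this.mono fun s hs => And.intro s.finite_toSet hs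
  refine ⟨⋃ n, C n, Set.subset_iUnion C 0, Set.countable_iUnion hcount, fun s hs => ?_⟩
  obtain ⟨n, hn⟩ := (hmono.directed_le).exists_mem_subset_of_finset_subset_biUnion hs
  refine subset_trans ?_ (Set.subset_iUnion C (n + 1))
  rw [hC]
  exact subset_trans (Set.subset_biUnion_of_mem (u := Φ) hn) Set.subset_union_right

theorem exists_utility {V : Type*} [Countable V] (r : V → V → Prop) (hrefl : ∀ a, r a a)
    (htrans : ∀ a b c, r a b → r b c → r a c) (htotal : ∀ a b, r a b ∨ r b a) :
    ∃ u : V → ℝ, ∀ a b, u a ≥ u b ↔ r a b := by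
  classical
  let : Preorder V :=
    { le := fun a b => r b a
      le_refl := hrefl
      le_trans := fun a b c hab hbc => htrans c b a hbc hab }
  have : @Std.Total V (· ≤ ·) := ⟨fun a b => htotal b a⟩
  have : Countable (Antisymmetrization V (· ≤ ·)) :=
    inferInstanceAs (Countable (Quotient _))
  obtain ⟨f⟩ := Order.embedding_from_countable_to_dense (Antisymmetrization V (· ≤ ·)) ℝ
  refine ⟨fun a => f (toAntisymmetrization (· ≤ ·) a), fun a b => ?_⟩
  rw [ge_iff_le, f.le_iff_le, toAntisymmetrization_le_toAntisymmetrization_iff]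
  rfl

/-! ### Symbols and subformulas -/

variable {S : Signature.{u₁, u₂}}

/-- The function symbols, with their arities, that occur in a term. -/
def termSymbols {L : FirstOrder.Language.{u₁, u₂}} :
    L.Term ℕ → Set (Σ n, L.Functions n)
  | .var _ => ∅
  | .func f ts => insert ⟨_, f⟩ (⋃ i, termSymbols (ts i))

theorem countable_termSymbols {L : FirstOrder.Language.{u₁, u₂}} (τ : L.Term ℕ) :
    (termSymbols τ).Countable := by
  induction τ with
  | var _ => exact Set.countable_empty
  | func f ts ih => exact (Set.countable_iUnion ih).insert _

/-- The function symbols, with their arities, that occur in a formula. -/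
def Formula.functionSymbols : Formula S → Set (Σ n, S.symbols.Functions n)
  | .eq τ σ => termSymbols τ ∪ termSymbols σ
  | .rel _ τ => ⋃ i, termSymbols (τ i)
  | .neg θ => θ.functionSymbols
  | .and θ ψ => θ.functionSymbols ∪ ψ.functionSymbols
  | .ex _ ψ => ψ.functionSymbols
  | .pref _ θ ψ => θ.functionSymbols ∪ ψ.functionSymbols

theorem Formula.countable_functionSymbols (φ : Formula S) : φ.functionSymbols.Countable := by
  induction φ with
  | eq τ σ => exact (countable_termSymbols τ).union (countable_termSymbols σ)
  | rel P τ => exact Set.countable_iUnion fun i => countable_termSymbols (τ i)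
  | neg θ ih => exact ih
  | and θ ψ ihθ ihψ => exact ihθ.union ihψ
  | ex x ψ ih => exact ih
  | pref X θ ψ ihθ ihψ => exact ihθ.union ihψ

/-- The subformulas of a formula, including the formula itself. -/
def Formula.subformulas : Formula S → Set (Formula S)
  | .eq τ σ => {.eq τ σ}
  | .rel P τ => {.rel P τ}
  | .neg θ => insert (.neg θ) θ.subformulas
  | .and θ ψ => insert (.and θ ψ) (θ.subformulas ∪ ψ.subformulas)
  | .ex x ψ => insert (.ex x ψ) ψ.subformulas
  | .pref X θ ψ => insert (.pref X θ ψ) (θ.subformulas ∪ ψ.subformulas)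

theorem Formula.self_mem_subformulas (φ : Formula S) : φ ∈ φ.subformulas := by
  cases φ <;> simp [Formula.subformulas]

theorem Formula.countable_subformulas (φ : Formula S) : φ.subformulas.Countable := by
  induction φ with
  | eq τ σ => exact Set.countable_singleton _
  | rel P τ => exact Set.countable_singleton _
  | neg θ ih => exact ih.insert _
  | and θ ψ ihθ ihψ => exact (ihθ.union ihψ).insert _
  | ex x ψ ih => exact ih.insert _
  | pref X θ ψ ihθ ihψ => exact (ihθ.union ihψ).insert _

/-! ### Finite updates of an assignment -/

/-- The assignments obtained from `d₀` by finitely many updates with values in `E`. A list of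
pairs (variable, value) codes the updates. -/
def updates {D : Type*} (d₀ : ℕ → D) (E : Set D) : Set (ℕ → D) :=
  (fun l : List (ℕ × D) => l.foldr (fun p d => Function.update d p.1 p.2) d₀) ''
    {l | ∀ p ∈ l, p.2 ∈ E}

section updates

variable {D : Type*} {d₀ : ℕ → D} {E : Set D}

theorem self_mem_updates : d₀ ∈ updates d₀ E := ⟨[], by simp, rfl⟩

theorem update_mem_updates {d : ℕ → D} (hd : d ∈ updates d₀ E) (x : ℕ) {e : D} (he : e ∈ E) :
    Function.update d x e ∈ updates d₀ E := by
  obtain ⟨l, hl, rfl⟩ := hd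
  exact ⟨(x, e) :: l, List.forall_mem_cons.2 ⟨he, hl⟩, rfl⟩

theorem countable_updates (hE : E.Countable) : (updates d₀ E).Countable := by
  have := hE.to_subtype
  refine Set.Countable.image ?_ _
  refine (Set.countable_range
    (List.map fun p : ℕ × E => ((p.1, (p.2 : D)) : ℕ × D))).mono fun l hl => ?_
  refine ⟨l.pmap (fun p hp => (p.1, ⟨p.2, hp⟩)) hl, ?_⟩
  simp [List.map_pmap]

theorem exists_finset_of_mem_updates {d : ℕ → D} (hd : d ∈ updates d₀ E) :
    ∃ s : Finset D, (s : Set D) ⊆ E ∧ d ∈ updates d₀ s := by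
  classical
  obtain ⟨l, hl, rfl⟩ := hd
  refine ⟨(l.map Prod.snd).toFinset, fun e he => ?_, l, fun p hp => ?_, rfl⟩
  · obtain ⟨p, hp, rfl⟩ : ∃ p ∈ l, p.2 = e := by simpa using he
    exact hl p hp
  · simpa using ⟨p.1, hp⟩

end updates

/-! ### Restricting a model to a hull -/

/-- The propositions expressed by formulas in `Γ` under finite updates of `d₀` by values
in `E`. -/
def Base.propositions (B : Base.{u₁, u₂, v, w} S) (R : S.indices → B.W → B.W → Prop)
    (Γ : Set (Formula S)) (d₀ : ℕ → B.D) (E : Set B.D) : Set (Set B.W) :=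
  Set.image2 (B.meaning R) Γ (updates d₀ E)

/-- The closure conditions on a set `E` of individuals and a set `V` of worlds under which
restricting the model to `E` and `V` does not affect the formulas in `Γ`, provided that their
function symbols are in `F`. -/
structure IsHull (B : Base.{u₁, u₂, v, w} S) (R : S.indices → B.W → B.W → Prop)
    (Γ : Set (Formula S)) (F : Set (Σ n, S.symbols.Functions n)) (d₀ : ℕ → B.D)
    (E : Set B.D) (V : Set B.W) : Prop where
  funMap_mem : ∀ a ∈ V, ∀ f ∈ F, ∀ e : Fin f.1 → B.D, (∀ i, e i ∈ E) →
    (B.t a).funMap f.2 e ∈ E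
  exists_witness : ∀ ψ ∈ Γ, ∀ d ∈ updates d₀ E, ∀ a ∈ V, ∀ x : ℕ,
    (∃ e, a ∈ B.meaning R ψ (Function.update d x e)) →
      ∃ e ∈ E, a ∈ B.meaning R ψ (Function.update d x e)
  s_mem : ∀ A ∈ B.propositions R Γ d₀ E, ∀ hA : A.Nonempty, ∀ a ∈ V, B.s a ⟨A, hA⟩ ∈ V
  eq_of_trace_eq : ∀ A ∈ B.propositions R Γ d₀ E, ∀ A' ∈ B.propositions R Γ d₀ E,
    (∀ a ∈ V, a ∈ A ↔ a ∈ A') → A = A'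

open Classical in
/-- The restriction of a model to a set `E` of individuals and a set `V` of worlds. A function
value outside `E` is replaced by an arbitrary element of `E`. The selection from the trace on `V`
of a proposition in `𝒜` is the original selection from that proposition; from any other set, an
arbitrary member is selected. -/
noncomputable def Base.restrict (B : Base.{u₁, u₂, v, w} S) (𝒜 : Set (Set B.W))
    (E : Set B.D) (V : Set B.W) (hE : E.Nonempty) (hV : V.Nonempty) :
    Base.{u₁, u₂, v, w} S where
  D := E
  W := V
  nonempty_D := hE.to_subtype
  nonempty_W := hV.to_subtype
  t a :=
    { funMap := fun f e =>
        if h : (B.t a).funMap f (fun i => (e i : B.D)) ∈ E then ⟨_, h⟩ else ⟨_, hE.some_mem⟩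
      RelMap := fun P e => (B.t a).RelMap P (fun i => (e i : B.D)) }
  s a A :=
    if h : ∃ A₀ : {A : Set B.W // A.Nonempty},
        A₀.1 ∈ 𝒜 ∧ A.1 = Subtype.val ⁻¹' A₀.1 ∧ B.s a A₀ ∈ V then
      ⟨B.s a h.choose, h.choose_spec.2.2⟩
    else A.2.some
  s_mem a A := by
    split_ifs with h
    · exact h.choose_spec.2.1.ge (B.s_mem a h.choose)
    · exact A.2.some_mem

namespace IsHull

variable {B : Base.{u₁, u₂, v, w} S} {R : S.indices → B.W → B.W → Prop}
  {Γ : Set (Formula S)} {F : Set (Σ n, S.symbols.Functions n)} {d₀ : ℕ → B.D}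
  {E : Set B.D} {V : Set B.W}

theorem realize_restrict (H : IsHull B R Γ F d₀ E V) (hE : E.Nonempty) (hV : V.Nonempty)
    (𝒜 : Set (Set B.W)) (a : V) (d : ℕ → E) (τ : S.symbols.Term ℕ)
    (hτ : termSymbols τ ⊆ F) :
    (@FirstOrder.Language.Term.realize _ E ((B.restrict 𝒜 E V hE hV).t a) _ d τ : B.D) =
      @FirstOrder.Language.Term.realize _ B.D (B.t a) _ (fun n => (d n : B.D)) τ := by
  induction τ with
  | var n => rfl
  | @func n f ts ih =>
    have hi : ∀ i, termSymbols (ts i) ⊆ F := fun i =>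
      subset_trans (Set.subset_iUnion (fun i => termSymbols (ts i)) i)
        (subset_trans (Set.subset_insert _ _) hτ)
    have hf : (⟨n, f⟩ : Σ n, S.symbols.Functions n) ∈ F := hτ (Set.mem_insert _ _)
    simp only [FirstOrder.Language.Term.realize]
    rw [← funext fun i => ih i (hi i)]
    refine congrArg Subtype.val (dif_pos ?_)
    exact H.funMap_mem a a.2 _ hf _ fun i => Subtype.property _

theorem s_restrict (H : IsHull B R Γ F d₀ E V) (hE : E.Nonempty) (hV : V.Nonempty)
    (a : V) (A : Set V) (hA : A.Nonempty) (A₀ : Set B.W) (hA₀ : A₀.Nonempty)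
    (hmem : A₀ ∈ B.propositions R Γ d₀ E) (h : A = Subtype.val ⁻¹' A₀) :
    Subtype.val (p := (· ∈ V))
        ((B.restrict (B.propositions R Γ d₀ E) E V hE hV).s a ⟨A, hA⟩) =
      B.s a ⟨A₀, hA₀⟩ := by
  have hex : ∃ A₀ : {A : Set B.W // A.Nonempty}, A₀.1 ∈ B.propositions R Γ d₀ E ∧
      A = Subtype.val ⁻¹' A₀.1 ∧ B.s a A₀ ∈ V :=
    ⟨⟨A₀, hA₀⟩, hmem, h, H.s_mem A₀ hmem hA₀ a a.2⟩
  have hchoose : hex.choose = ⟨A₀, hA₀⟩ := by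
    refine Subtype.ext (H.eq_of_trace_eq _ hex.choose_spec.1 _ hmem fun b hb => ?_)
    have := hex.choose_spec.2.1.symm.trans h
    exact Set.ext_iff.1 this ⟨b, hb⟩
  refine (congrArg Subtype.val (dif_pos hex)).trans ?_
  exact congrArg (B.s a) hchoose

/-- The restriction of a model to a hull preserves the meaning of the formulas in `Γ`. -/
theorem meaning_restrict (H : IsHull B R Γ F d₀ E V) (hE : E.Nonempty) (hV : V.Nonempty)
    (ψ : Formula S) (hΓ : ψ.subformulas ⊆ Γ) (hF : ψ.functionSymbols ⊆ F)
    (d : ℕ → E) (hd : (fun n => (d n : B.D)) ∈ updates d₀ E) :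
    (B.restrict (B.propositions R Γ d₀ E) E V hE hV).meaning
        (fun X (a b : V) => R X a b) ψ d =
      (Subtype.val ⁻¹' B.meaning R ψ (fun n => (d n : B.D)) : Set V) := by
  induction ψ generalizing d with
  | eq τ σ =>
    refine Set.ext fun (a : V) => ?_
    simp only [Formula.functionSymbols, Set.union_subset_iff] at hF
    have h₁ := H.realize_restrict hE hV (B.propositions R Γ d₀ E) a d τ hF.1
    have h₂ := H.realize_restrict hE hV (B.propositions R Γ d₀ E) a d σ hF.2
    exact Subtype.ext_iff.trans (iff_of_eq (congrArg₂ (· = ·) h₁ h₂))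
  | rel P τ =>
    refine Set.ext fun (a : V) => ?_
    simp only [Formula.functionSymbols, Set.iUnion_subset_iff] at hF
    have h := funext fun i =>
      H.realize_restrict hE hV (B.propositions R Γ d₀ E) a d (τ i) (hF i)
    exact iff_of_eq (congrArg ((B.t a).RelMap P) h)
  | neg θ ih =>
    simp only [Base.meaning]
    rw [ih (subset_trans (Set.subset_insert _ _) hΓ) hF d hd]
    rfl
  | and θ ψ ihθ ihψ =>
    have hΓ' := Set.union_subset_iff.1 (subset_trans (Set.subset_insert _ _) hΓ)
    have hF' := Set.union_subset_iff.1 hF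
    simp only [Base.meaning]
    rw [ihθ hΓ'.1 hF'.1 d hd, ihψ hΓ'.2 hF'.2 d hd]
    rfl
  | ex x ψ ih =>
    have hΓ' : ψ.subformulas ⊆ Γ := subset_trans (Set.subset_insert _ _) hΓ
    have key : ∀ e : E, (B.restrict (B.propositions R Γ d₀ E) E V hE hV).meaning
        (fun X (a b : V) => R X a b) ψ (Function.update d x e) =
        (Subtype.val ⁻¹' B.meaning R ψ (Function.update (fun n => (d n : B.D)) x e)
          : Set V) := by
      intro e
      have hupd : (fun n => (Function.update d x e n : B.D)) =
          Function.update (fun n => (d n : B.D)) x e :=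
        Function.comp_update Subtype.val d x e
      rw [← hupd]
      exact ih hΓ' hF _ (hupd ▸ update_mem_updates hd x e.2)
    refine Set.ext fun (a : V) => ?_
    constructor
    · rintro ⟨(e : E), he⟩
      exact ⟨e, (Set.ext_iff.1 (key e) a).1 he⟩
    · intro h
      obtain ⟨e, heE, he⟩ :=
        H.exists_witness ψ (hΓ' ψ.self_mem_subformulas) _ hd a a.2 x h
      exact ⟨⟨e, heE⟩, (Set.ext_iff.1 (key ⟨e, heE⟩) a).2 he⟩
  | pref X θ ψ ihθ ihψ =>
    have hΓ' := Set.union_subset_iff.1 (subset_trans (Set.subset_insert _ _) hΓ)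
    have hF' := Set.union_subset_iff.1 hF
    have hθ := ihθ hΓ'.1 hF'.1 d hd
    have hψ := ihψ hΓ'.2 hF'.2 d hd
    have mθ : B.meaning R θ (fun n => (d n : B.D)) ∈ B.propositions R Γ d₀ E :=
      ⟨θ, hΓ'.1 θ.self_mem_subformulas, _, hd, rfl⟩
    have mψ : B.meaning R ψ (fun n => (d n : B.D)) ∈ B.propositions R Γ d₀ E :=
      ⟨ψ, hΓ'.2 ψ.self_mem_subformulas, _, hd, rfl⟩
    refine Set.ext fun (a : V) => ?_
    constructor
    · rintro ⟨nθ, nψ, h⟩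
      have nθ' : (B.meaning R θ (fun n => (d n : B.D))).Nonempty :=
        let ⟨b, hb⟩ := nθ; ⟨_, (Set.ext_iff.1 hθ b).1 hb⟩
      have nψ' : (B.meaning R ψ (fun n => (d n : B.D))).Nonempty :=
        let ⟨b, hb⟩ := nψ; ⟨_, (Set.ext_iff.1 hψ b).1 hb⟩
      refine ⟨nθ', nψ', ?_⟩
      rw [← H.s_restrict hE hV a _ nθ _ nθ' mθ hθ, ← H.s_restrict hE hV a _ nψ _ nψ' mψ hψ]
      exact h
    · rintro ⟨nθ', nψ', h⟩
      -- A nonempty proposition meets `V`, because `V` contains the world selected from it.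
      have nθ : ((B.restrict (B.propositions R Γ d₀ E) E V hE hV).meaning
          (fun X (a b : V) => R X a b) θ d).Nonempty :=
        ⟨⟨_, H.s_mem _ mθ nθ' a a.2⟩, (Set.ext_iff.1 hθ _).2 (B.s_mem a ⟨_, nθ'⟩)⟩
      have nψ : ((B.restrict (B.propositions R Γ d₀ E) E V hE hV).meaning
          (fun X (a b : V) => R X a b) ψ d).Nonempty :=
        ⟨⟨_, H.s_mem _ mψ nψ' a a.2⟩, (Set.ext_iff.1 hψ _).2 (B.s_mem a ⟨_, nψ'⟩)⟩
      refine ⟨nθ, nψ, ?_⟩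
      rw [← H.s_restrict hE hV a _ nθ _ nθ' mθ hθ,
        ← H.s_restrict hE hV a _ nψ _ nψ' mψ hψ] at h
      exact h

end IsHull

/-! ### Existence of countable hulls -/

theorem exists_countable_isHull (B : Base.{u₁, u₂, v, w} S)
    (R : S.indices → B.W → B.W → Prop) {Γ : Set (Formula S)} (hΓ : Γ.Countable)
    {F : Set (Σ n, S.symbols.Functions n)} (hF : F.Countable) (d₀ : ℕ → B.D) (a₀ : B.W) :
    ∃ (E : Set B.D) (V : Set B.W), (∀ n, d₀ n ∈ E) ∧ a₀ ∈ V ∧ V.Countable ∧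
      IsHull B R Γ F d₀ E V := by
  classical
  have hwit : ∀ (ψ : Formula S) (x : ℕ) (d : ℕ → B.D) (a : B.W), ∃ e,
      (∃ e, a ∈ B.meaning R ψ (Function.update d x e)) →
        a ∈ B.meaning R ψ (Function.update d x e) := by
    intro ψ x d a
    by_cases h : ∃ e, a ∈ B.meaning R ψ (Function.update d x e)
    · exact ⟨h.choose, fun _ => h.choose_spec⟩
    · exact ⟨d₀ 0, fun h' => absurd h' h⟩
  choose wit hwit using hwit
  have hsel : ∀ (a : B.W) (A : Set B.W), ∃ b, ∀ hA : A.Nonempty, B.s a ⟨A, hA⟩ = b := by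
    intro a A
    by_cases hA : A.Nonempty
    · exact ⟨B.s a ⟨A, hA⟩, fun _ => rfl⟩
    · exact ⟨a₀, fun h => absurd h hA⟩
  choose sel hsel using hsel
  have hsep : ∀ A A' : Set B.W, ∃ a, (a ∈ A ↔ a ∈ A') → A = A' := by
    intro A A'
    by_contra! h
    exact (h a₀).2 (Set.ext fun a => (h a).1)
  choose sep hsep using hsep
  -- Individuals and worlds are closed off together, as elements of one disjoint union.
  let EE : Set (B.D ⊕ B.W) → Set B.D := fun C => Sum.inl ⁻¹' C
  let VV : Set (B.D ⊕ B.W) → Set B.W := fun C => Sum.inr ⁻¹' C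
  let PP : Set (B.D ⊕ B.W) → Set (Set B.W) := fun C => B.propositions R Γ d₀ (EE C)
  let Φ : Set (B.D ⊕ B.W) → Set (B.D ⊕ B.W) := fun C =>
    (Set.range fun p : VV C × (Σ f : F, (Fin f.1.1 → EE C)) =>
      Sum.inl ((B.t p.1).funMap p.2.1.1.2 fun i => (p.2.2 i : B.D))) ∪
    (Set.range fun p : Γ × ℕ × updates d₀ (EE C) × VV C =>
      Sum.inl (wit p.1 p.2.1 p.2.2.1 p.2.2.2)) ∪
    (Set.range fun p : VV C × PP C => Sum.inr (sel p.1 p.2)) ∪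
    (Set.range fun p : PP C × PP C => Sum.inr (sep p.1 p.2))
  have hΦ : ∀ s : Finset (B.D ⊕ B.W), (Φ s).Countable := by
    intro s
    have hE : (EE s).Countable := s.countable_toSet.preimage Sum.inl_injective
    have hV : (VV s).Countable := s.countable_toSet.preimage Sum.inr_injective
    have hU : (updates d₀ (EE s)).Countable := countable_updates hE
    have hP : (PP s).Countable := hΓ.image2 hU _
    have := hE.to_subtype
    have := hV.to_subtype
    have := hU.to_subtype
    have := hP.to_subtype
    have := hΓ.to_subtype
    have := hF.to_subtype
    exact (((Set.countable_range _).union (Set.countable_range _)).union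
      (Set.countable_range _)).union (Set.countable_range _)
  obtain ⟨C, hAC, hC, hcl⟩ := exists_countable_closed
    (((Set.countable_range d₀).image Sum.inl).union (Set.countable_singleton (Sum.inr a₀)))
    (fun s => Φ s) hΦ
  have hlift : ∀ d ∈ updates d₀ (EE C), ∃ s : Finset (B.D ⊕ B.W), (s : Set _) ⊆ C ∧
      ∀ s' : Finset (B.D ⊕ B.W), s ⊆ s' → d ∈ updates d₀ (EE s') := by
    intro d hd
    obtain ⟨s, hs, l, hl, rfl⟩ := exists_finset_of_mem_updates hd
    refine ⟨s.image Sum.inl, ?_, fun s' hs' => ⟨l, fun p hp => ?_, rfl⟩⟩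
    · intro z hz
      obtain ⟨e, he, rfl⟩ := Finset.mem_image.1 (Finset.mem_coe.1 hz)
      exact hs he
    · exact hs' (Finset.mem_image_of_mem _ (hl p hp))
  have hliftP : ∀ A ∈ PP C, ∃ s : Finset (B.D ⊕ B.W), (s : Set _) ⊆ C ∧
      ∀ s' : Finset (B.D ⊕ B.W), s ⊆ s' → A ∈ PP s' := by
    rintro _ ⟨ψ, hψ, d, hd, rfl⟩
    obtain ⟨s, hs, h⟩ := hlift d hd
    exact ⟨s, hs, fun s' hs' => ⟨ψ, hψ, d, h s' hs', rfl⟩⟩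
  refine ⟨EE C, VV C, fun n => hAC (Or.inl ⟨_, ⟨n, rfl⟩, rfl⟩), hAC (Or.inr rfl),
    hC.preimage Sum.inr_injective, ?_, ?_, ?_, ?_⟩
  · intro a ha f hf e he
    let s : Finset (B.D ⊕ B.W) := insert (Sum.inr a) (Finset.univ.image fun i => Sum.inl (e i))
    have hs : (s : Set (B.D ⊕ B.W)) ⊆ C := by
      intro z hz
      rcases Finset.mem_insert.1 (Finset.mem_coe.1 hz) with rfl | hz
      · exact ha
      · obtain ⟨i, -, rfl⟩ := Finset.mem_image.1 hz
        exact he i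
    refine hcl s hs (Or.inl (Or.inl (Or.inl ⟨⟨⟨a, ?_⟩, ⟨⟨f, hf⟩, fun i => ⟨e i, ?_⟩⟩⟩, rfl⟩)))
    · exact show Sum.inr a ∈ s from Finset.mem_insert_self _ _
    · exact show Sum.inl (e i) ∈ s from
        Finset.mem_insert_of_mem (Finset.mem_image_of_mem _ (Finset.mem_univ i))
  · intro ψ hψ d hd a ha x hex
    obtain ⟨s, hs, h⟩ := hlift d hd
    refine ⟨wit ψ x d a, ?_, hwit ψ x d a hex⟩
    refine hcl (insert (Sum.inr a) s) ?_ (Or.inl (Or.inl (Or.inr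
      ⟨⟨⟨ψ, hψ⟩, x, ⟨d, h _ (Finset.subset_insert _ _)⟩, ⟨a, ?_⟩⟩, rfl⟩)))
    · rw [Finset.coe_insert]
      exact Set.insert_subset ha hs
    · exact Finset.mem_coe.2 (Finset.mem_insert_self _ _)
  · intro A hA hne a ha
    obtain ⟨s, hs, h⟩ := hliftP A hA
    rw [hsel a A hne]
    refine hcl (insert (Sum.inr a) s) ?_ (Or.inl (Or.inr
      ⟨⟨⟨a, ?_⟩, ⟨A, h _ (Finset.subset_insert _ _)⟩⟩, rfl⟩))
    · rw [Finset.coe_insert]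
      exact Set.insert_subset ha hs
    · exact Finset.mem_coe.2 (Finset.mem_insert_self _ _)
  · intro A hA A' hA' heq
    obtain ⟨s, hs, h⟩ := hliftP A hA
    obtain ⟨s', hs', h'⟩ := hliftP A' hA'
    refine hsep A A' (heq _ ?_)
    refine hcl (s ∪ s') ?_ (Or.inr
      ⟨⟨⟨A, h _ Finset.subset_union_left⟩, ⟨A', h' _ Finset.subset_union_right⟩⟩, rfl⟩)
    rw [Finset.coe_union]
    exact Set.union_subset hs hs'

end PrefLogic

open PrefLogic in
theorem proposition4p7 (S : PrefLogic.Signature.{u₁, u₂}) (θ : PrefLogic.Formula S) :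
    PrefLogic.ValidInUtilityModels.{u₁, u₂, v, w} θ ↔
      PrefLogic.ValidInPreorderModels.{u₁, u₂, v, w} θ := by
  constructor
  · intro hvalid M
    refine Set.iInter_eq_univ.2 fun d₀ => Set.eq_univ_of_forall fun a₀ => ?_
    obtain ⟨E, V, hd₀, ha₀, hV, H⟩ := exists_countable_isHull M.toBase M.ge
      θ.countable_subformulas θ.countable_functionSymbols d₀ a₀
    have : Countable V := hV.to_subtype
    choose u hu using fun X : S.indices => exists_utility (fun a b : V => M.ge X a b)
      (fun a => M.ge_refl X a) (fun a b c => M.ge_trans X a b c) (fun a b => M.ge_total X a b)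
    let N : UtilityModel.{u₁, u₂, v, w} S :=
      { toBase := M.toBase.restrict (M.toBase.propositions M.ge θ.subformulas d₀ E) E V
          ⟨_, hd₀ 0⟩ ⟨_, ha₀⟩
        u := u }
    have hR : (fun X (a b : V) => u X a ≥ u X b) = fun X (a b : V) => M.ge X a b := by
      funext X a b
      exact propext (hu X a b)
    have hN := Set.eq_univ_iff_forall.1 (Set.iInter_eq_univ.1 (hvalid N) fun n => ⟨d₀ n, hd₀ n⟩)
      ⟨a₀, ha₀⟩
    have key := H.meaning_restrict ⟨_, hd₀ 0⟩ ⟨_, ha₀⟩ θ subset_rfl subset_rfl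
      (fun n => ⟨d₀ n, hd₀ n⟩) self_mem_updates
    rw [← hR] at key
    exact (Set.ext_iff.1 key ⟨a₀, ha₀⟩).1 hN
  · intro hvalid M
    exact hvalid
      { toBase := M.toBase
        ge := fun X a b => M.u X a ≥ M.u X b
        ge_refl := fun X a => le_refl _
        ge_trans := fun X a b c hab hbc => le_trans hbc hab
        ge_total := fun X a b => le_total _ _ }
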